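/- Let $n\ge 2$, $k=n-1$, and let $R(T)=\mathbb{Z}[e^{\pm a_1},\ldots,e^{\pm a_n}]/(e^{a_1+\cdots+a_n}-1)$, with indices of $a_i$ read modulo $n$ (so $a_0=a_n$), and $b_i=1-e^{-a_i}$. Put $\alpha_i=a_i-a_{i+1}$ for $i\in\mathbb{Z}/n\mathbb{Z}$. On formal power series in $y=(y_1,y_2,\ldots)$ with coefficients in $R(T)$, let $s_i$ ($1\le i\le n-1$) exchange $a_i$ and $a_{i+1}$ in the coefficients, and let $s_0(f)=\frac{\Omega(b_1|y)}{\Omega(b_n|y)}\,s_\theta(f)$, where $s_\theta$ exchanges $a_1$ and $a_n$ in the coefficients and $\Omega(c|y)=\prod_{j\ge1}(1-c\,y_j)^{-1}$. Let $T_i=(1-e^{\alpha_i})^{-1}(s_i-1)$ and $D_i=T_i+1$. For a $k$-bounded partition $\lambda$ (that is, $\lambda_1\le k$), let $x_\lambda=s_{i_1}\cdots s_{i_l}$ be the corresponding affine Grassmannian element; the reduced word $i_1,\ldots,i_l$ lists the $n$-residues $j-i \bmod n$ of the boxes $(i,j)$ of $\lambda$, each row read from right to left, starting with the bottom row. The $K$-theoretic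 double $k$-Schur function and its closed version are $$g^{(k)}_\lambda(y|b)=T_{i_1}\cdots T_{i_l}(1),\qquad \tilde g^{(k)}_\lambda(y|b)=D_{i_1}\cdots D_{i_l}(1).$$ Let $\sigma$ be the $R(T)$-linear substitution $f(y_1,y_2,\ldots)\mapsto f(1,y_1,y_2,\ldots)$, where the sums over powers of the variable set equal to $1$ are taken in the $(b_1,\ldots,b_n)$-adic topology of $R(T)$ (for example $\sigma(\Omega(b_i|y))=e^{a_i}\Omega(b_i|y)$). (i) Let $\lambda$ be $k$-small, i.e. $k$-bounded with $\lambda_1+\ell(\lambda)\le n$, where $\ell(\lambda)$ is the number of nonzero parts. Then $\sigma(g^{(k)}_\lambda(y|b))$ is defined and $$\sigma(g^{(k)}_\lambda(y|b))=\Bigl(\prod_{x\in\mathrm{diag}(\lambda)}e^{a_{r(x)+1}-a_{b(x)}}\Bigr)\,\tilde g^{(k)}_\lambda(y|b),$$ where $\mathrm{diag}(\lambda)$ is the set of boxes $(i,i)$ of $\lambda$, and $r(x)$ (resp. $b(x)$) is the $n$-residue of the last box of $\lambda$ in the row (resp. column) of $x$. (ii) The assumption of $k$-smallness cannot be dropped: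 for $n=3$ the $2$-bounded partition $(2,1)$ is not $2$-small, and $$\sigma(g^{(2)}_{(2,1)}(y|b))=\tilde g^{(2)}_{(2)}(y|b)+e^{a_3-a_2}\,\tilde g^{(2)}_{(2,1)}(y|b),$$ which is not of the form $c\,\tilde g^{(2)}_{(2,1)}(y|b)$ with $c\in R(T)$. -/

import Mathlib

namespace DoubleKSchur

/-! ### The representation ring `R(T)` of the maximal torus of `SL_n` -/

/-- The character lattice `ℤⁿ / ℤ(1,…,1)` of the maximal torus of `SL_n`.  The coordinates are
indexed by `ZMod n`, with the index `n` identified with `0`. -/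
abbrev CharLattice (n : ℕ) : Type :=
  (ZMod n → ℤ) ⧸ AddSubgroup.zmultiples (fun _ => 1 : ZMod n → ℤ)

/-- The character `a_i`, so that `a_1 + ⋯ + a_n = 0` and `a_n = a_0`. -/
def a (n : ℕ) (i : ZMod n) : CharLattice n :=
  QuotientAddGroup.mk (Pi.single i 1)

/-- `R(T) = ℤ[e^{± a_1}, …, e^{± a_n}] / (e^{a_1 + ⋯ + a_n} - 1)`, as the group ring of the
character lattice. -/
abbrev RT (n : ℕ) : Type := AddMonoidAlgebra ℤ (CharLattice n)

/-- The element `e^v` of `R(T)`. -/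
noncomputable def ex {n : ℕ} (v : CharLattice n) : RT n := AddMonoidAlgebra.single v 1

/-- The equivariant parameter `b_i = 1 - e^{-a_i}`. -/
noncomputable def b (n : ℕ) (i : ZMod n) : RT n := 1 - ex (-a n i)

/-- The simple root `α_i = a_i - a_{i+1}`.  For `i = 0` this is the level zero affine root
`α_0 = -θ = a_n - a_1`. -/
def simpleRoot (n : ℕ) (i : ZMod n) : CharLattice n := a n i - a n (i + 1)

/-- The reflection exchanging `a_i` and `a_{i+1}` on characters; for `i = 0` this is `s_θ`,
exchanging `a_1` and `a_n`. -/
def reflChar (n : ℕ) (i : ZMod n) : CharLattice n →+ CharLattice n :=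
  QuotientAddGroup.map _ _
    (AddMonoidHom.mk' (fun v : ZMod n → ℤ => fun j => v (Equiv.swap i (i + 1) j))
      (fun _ _ => rfl))
    (by
      rw [AddSubgroup.zmultiples_le]
      exact AddSubgroup.mem_zmultiples _)

/-- The ring automorphism of `R(T)` exchanging `a_i` and `a_{i+1}`. -/
noncomputable def reflRT (n : ℕ) (i : ZMod n) : RT n →+* RT n :=
  AddMonoidAlgebra.mapDomainRingHom ℤ (reflChar n i)

/-! ### Power series in `y` and the Demazure operators -/

/-- Formal power series in the infinitely many variables `y` (here `y 0, y 1, …`) over `R(T)`. -/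
abbrev PS (n : ℕ) : Type := MvPowerSeries ℕ (RT n)

/-- `Ω(c|y) = ∏_j 1 / (1 - c y_j)`: since `1 / (1 - c y_j) = ∑_r c ^ r y_j ^ r`, the coefficient of
a monomial of total degree `d` in the product is `c ^ d`. -/
noncomputable def Omega {n : ℕ} (c : RT n) : PS n := fun m => c ^ m.degree

/-- The action of the simple reflection `s_i` on power series: it exchanges `a_i` and `a_{i+1}` in
the coefficients, and `s_0 f = (Ω(b_1|y) / Ω(b_n|y)) s_θ f`.  (The constant coefficient of
`Ω(b_n|y)` is `1`, so `invOfUnit _ 1` is its inverse.) -/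
noncomputable def refl (n : ℕ) (i : ZMod n) (f : PS n) : PS n :=
  if i = 0 then
    Omega (b n 1) * MvPowerSeries.invOfUnit (Omega (b n 0)) 1 * MvPowerSeries.map (reflRT n 0) f
  else MvPowerSeries.map (reflRT n i) f

theorem ex_add {n : ℕ} (v w : CharLattice n) : ex (v + w) = ex v * ex w := by
  simp [ex, AddMonoidAlgebra.single_mul_single]

theorem ex_zero {n : ℕ} : ex (0 : CharLattice n) = 1 := rfl

/-- On characters, the reflection `s_i` changes `v` by a multiple of `α_i`. -/
theorem reflChar_eq (n : ℕ) (i : ZMod n) (v : CharLattice n) :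
    ∃ m : ℤ, reflChar n i v = v + m • simpleRoot n i := by
  induction v using QuotientAddGroup.induction_on with
  | H v =>
    refine ⟨v (i + 1) - v i, ?_⟩
    change QuotientAddGroup.mk _ = QuotientAddGroup.mk
      (v + (v (i + 1) - v i) • (Pi.single i 1 - Pi.single (i + 1) 1))
    congr 1
    funext j
    by_cases h : i = i + 1
    · simp [← h]
    · by_cases h1 : j = i
      · subst h1
        simp [h]
      · by_cases h2 : j = i + 1
        · subst h2
          simp [Ne.symm h]
        · simp [Equiv.swap_apply_of_ne_of_ne h1 h2, h1, h2]

/-- `s_i f - f` is divisible by `1 - e^{α_i}`, so that the Demazure operators are defined on power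
series over `R(T)`. -/
theorem exists_demazure (n : ℕ) (i : ZMod n) (f : PS n) :
    ∃ q : PS n, MvPowerSeries.C (1 - ex (simpleRoot n i)) * q = refl n i f - f := by
  set α := simpleRoot n i with hα
  obtain ⟨Q, _, π, hker⟩ : ∃ (Q : Type) (_ : CommRing Q) (π : RT n →+* Q),
      ∀ r, π r = 0 ↔ (1 - ex α) ∣ r :=
    ⟨RT n ⧸ Ideal.span {1 - ex α}, inferInstance, Ideal.Quotient.mk _, fun r => by
      rw [Ideal.Quotient.eq_zero_iff_mem, Ideal.mem_span_singleton]⟩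
  have hπα : π (ex α) = 1 := by
    have : π (1 - ex α) = 0 := (hker _).2 dvd_rfl
    rw [map_sub, map_one, sub_eq_zero] at this
    exact this.symm
  have hn : ∀ m : ℕ, π (ex (m • α)) = 1 := by
    intro m
    induction m with
    | zero => simp [ex_zero]
    | succ m ih => rw [succ_nsmul, ex_add, map_mul, ih, hπα, one_mul]
  have hz : ∀ m : ℤ, π (ex (m • α)) = 1 := by
    intro m
    obtain ⟨k, rfl | rfl⟩ := m.eq_nat_or_neg
    · simpa using hn k
    · have h1 := hn k
      have h2 : π (ex (k • α)) * π (ex (-(k • α))) = 1 := by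
        rw [← map_mul, ← ex_add, add_neg_cancel, ex_zero, map_one]
      rw [h1, one_mul] at h2
      simpa using h2
  have hs : ∀ r : RT n, π (reflRT n i r) = π r := by
    intro r
    induction r using AddMonoidAlgebra.induction_linear with
    | zero => simp
    | add x y hx hy => simp [hx, hy]
    | single v c =>
      obtain ⟨m, hm⟩ := reflChar_eq n i v
      have h1 : reflRT n i (AddMonoidAlgebra.single v c) = c • (ex v * ex (m • α)) := by
        rw [← ex_add, ← hm]
        simp [reflRT, ex]
      have h2 : (AddMonoidAlgebra.single v c : RT n) = c • ex v := by simp [ex]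
      rw [h1, h2, map_zsmul, map_zsmul, map_mul, hz, mul_one]
  have hmap : ∀ g : PS n, MvPowerSeries.map π (MvPowerSeries.map (reflRT n i) g) =
      MvPowerSeries.map π g := by
    intro g
    ext m
    simp [hs]
  have hdiff : MvPowerSeries.map π (refl n i f) = MvPowerSeries.map π f := by
    unfold refl
    split_ifs with h0
    · have hb : π (b n 1) = π (b n 0) := by
        have h1 : -a n 0 = -a n 1 + (-1 : ℤ) • α := by
          rw [hα, h0]
          simp only [simpleRoot, zero_add, neg_smul, one_smul]
          abel
        rw [b, b, h1, ex_add, map_sub, map_sub, map_mul, hz, mul_one]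
      have hO : MvPowerSeries.map π (Omega (b n 1)) = MvPowerSeries.map π (Omega (b n 0)) := by
        ext m
        change π (b n 1 ^ _) = π (b n 0 ^ _)
        rw [map_pow, map_pow, hb]
      have hinv : Omega (b n 0) * MvPowerSeries.invOfUnit (Omega (b n 0)) 1 = 1 := by
        apply MvPowerSeries.mul_invOfUnit
        change b n 0 ^ (0 : ℕ →₀ ℕ).degree = 1
        simp
      have hm0 := hmap f
      rw [h0] at hm0
      rw [map_mul, map_mul, hO, ← map_mul, hinv, map_one, one_mul, hm0]
    · exact hmap f
  have hdvd : ∀ m, ∃ q, (1 - ex α) * q = (refl n i f - f) m := by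
    intro m
    have h : π ((refl n i f - f) m) = 0 := by
      have := congrArg (MvPowerSeries.coeff m) hdiff
      rw [MvPowerSeries.coeff_map, MvPowerSeries.coeff_map, ← sub_eq_zero, ← map_sub] at this
      exact this
    obtain ⟨q, hq⟩ := (hker _).1 h
    exact ⟨q, hq.symm⟩
  choose q hq using hdvd
  let q' : PS n := q
  refine ⟨q', MvPowerSeries.ext fun m => ?_⟩
  rw [MvPowerSeries.coeff_C_mul]
  exact hq m

/-- The Demazure operator `T_i = (1 - e^{α_i})⁻¹ (s_i - 1)`: the quotient exists by
`exists_demazure` and is unique for `n ≥ 2` by `T_unique`. -/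
noncomputable def T (n : ℕ) (i : ZMod n) (f : PS n) : PS n := (exists_demazure n i f).choose

theorem T_spec (n : ℕ) (i : ZMod n) (f : PS n) :
    MvPowerSeries.C (1 - ex (simpleRoot n i)) * T n i f = refl n i f - f :=
  (exists_demazure n i f).choose_spec

theorem charLattice_torsionFree (n : ℕ) (v : CharLattice n) (m : ℕ) (hm : m ≠ 0)
    (h : m • v = 0) : v = 0 := by
  induction v using QuotientAddGroup.induction_on with
  | H v =>
    obtain ⟨c, hc⟩ := AddSubgroup.mem_zmultiples_iff.1
      ((QuotientAddGroup.eq_zero_iff (m • v)).1 h)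
    refine (QuotientAddGroup.eq_zero_iff v).2 (AddSubgroup.mem_zmultiples_iff.2 ⟨v 0, ?_⟩)
    funext j
    have h0 := congrFun hc 0
    have hj := congrFun hc j
    simp only [Pi.smul_apply, smul_eq_mul, mul_one, nsmul_eq_mul] at h0 hj ⊢
    exact mul_left_cancel₀ (Nat.cast_ne_zero.2 hm) (h0.symm.trans hj)

instance (n : ℕ) : IsAddTorsionFree (CharLattice n) where
  nsmul_right_injective m hm v w h := by
    have h' : m • (v - w) = 0 := by rw [nsmul_sub, sub_eq_zero]; exact h
    exact sub_eq_zero.1 (charLattice_torsionFree n _ m hm h')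

/-- For `n ≥ 2`, `T_i f` is the only solution of `(1 - e^{α_i}) q = s_i f - f`. -/
theorem T_unique (n : ℕ) (hn : 2 ≤ n) (i : ZMod n) (f q : PS n)
    (h : MvPowerSeries.C (1 - ex (simpleRoot n i)) * q = refl n i f - f) : T n i f = q := by
  have : NeZero n := ⟨by omega⟩
  have : Fact (1 < n) := ⟨hn⟩
  have hne : (1 - ex (simpleRoot n i) : RT n) ≠ 0 := by
    intro h0
    have h1 : ex (simpleRoot n i) = ex 0 := (sub_eq_zero.1 h0).symm
    have h2 : simpleRoot n i = 0 := by
      have := congrArg AddMonoidAlgebra.coeff h1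
      simp only [ex, AddMonoidAlgebra.coeff_single] at this
      exact Finsupp.single_left_injective one_ne_zero this
    have h3 : QuotientAddGroup.mk (Pi.single i 1 - Pi.single (i + 1) 1) =
      (0 : CharLattice n) := h2
    obtain ⟨c, hc⟩ := AddSubgroup.mem_zmultiples_iff.1 ((QuotientAddGroup.eq_zero_iff _).1 h3)
    have hi := congrFun hc i
    have hi' := congrFun hc (i + 1)
    simp at hi hi'
    omega
  refine MvPowerSeries.ext fun m => ?_
  have h1 := congrArg (MvPowerSeries.coeff m) ((T_spec n i f).trans h.symm)
  rw [MvPowerSeries.coeff_C_mul, MvPowerSeries.coeff_C_mul] at h1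
  exact mul_left_cancel₀ hne h1

/-- The Demazure operator `D_i = T_i + 1`. -/
noncomputable def D (n : ℕ) (i : ZMod n) (f : PS n) : PS n := T n i f + f

/-! ### Bounded partitions and the `K`-theoretic double `k`-Schur functions

A partition is a Young diagram with boxes `(i, j)` (row, column), rows and columns counted from
`0`; throughout `k = n - 1`. -/

/-- `λ` is `k`-bounded: `λ_1 ≤ k = n - 1`. -/
def IsKBounded (n : ℕ) (lam : YoungDiagram) : Prop := lam.rowLen 0 ≤ n - 1

/-- `λ` is `k`-small: it is `k`-bounded and `λ_1 + ℓ(λ) ≤ n`. -/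
def IsKSmall (n : ℕ) (lam : YoungDiagram) : Prop :=
  IsKBounded n lam ∧ lam.rowLen 0 + lam.colLen 0 ≤ n

/-- The `n`-residue `j - i mod n` of the box in row `i` and column `j`. -/
def res (n : ℕ) (i j : ℕ) : ZMod n := (j : ZMod n) - (i : ZMod n)

/-- The reduced word `i_1, …, i_l` of the affine Grassmannian element
`x_λ = s_{i_1} ⋯ s_{i_l}` corresponding to a `k`-bounded partition `λ`: the residues of the boxes,
each row read from right to left, starting with the bottom row (so `i_l = 0` belongs to the corner
box). -/
def redWord (n : ℕ) (lam : YoungDiagram) : List (ZMod n) :=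
  ((List.range (lam.colLen 0)).flatMap fun i =>
    (List.range (lam.rowLen i)).map fun j => res n i j).reverse

/-- The `K`-theoretic double `k`-Schur function
`g_λ(y|b) = T_{x_λ}(1) = T_{i_1} ⋯ T_{i_l}(1)`. -/
noncomputable def g (n : ℕ) (lam : YoungDiagram) : PS n := (redWord n lam).foldr (T n) 1

/-- The closed `K`-theoretic double `k`-Schur function
`g̃_λ(y|b) = D_{x_λ}(1) = D_{i_1} ⋯ D_{i_l}(1)`. -/
noncomputable def gTilde (n : ℕ) (lam : YoungDiagram) : PS n := (redWord n lam).foldr (D n) 1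

/-- `∏_{x ∈ diag(λ)} e^{a_{r(x)+1} - a_{b(x)}}`, where for the diagonal box `x = (i, i)` the
residues `r(x)` and `b(x)` are those of the last box of row `i` and of the last box of
column `i`. -/
noncomputable def diagMonomial (n : ℕ) (lam : YoungDiagram) : RT n :=
  ∏ x ∈ lam.cells.filter (fun x => x.1 = x.2),
    ex (a n (res n x.1 (lam.rowLen x.1 - 1) + 1) - a n (res n (lam.colLen x.2 - 1) x.2))

/-! ### The substitution `σ : f(y) ↦ f(1, y)` -/

/-- The augmentation ideal of `R(T)`, generated by `b_1, …, b_n`. -/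
noncomputable def augIdeal (n : ℕ) : Ideal (RT n) := Ideal.span (Set.range (b n))

/-- The exponent of the monomial `y_0 ^ j · y_1 ^ {m 0} · y_2 ^ {m 1} ⋯`. -/
noncomputable def consExp (j : ℕ) (m : ℕ →₀ ℕ) : ℕ →₀ ℕ :=
  Finsupp.single 0 j + m.mapDomain Nat.succ

/-- `σ(f) = F`, where `σ : f(y_1, y_2, …) ↦ f(1, y_1, y_2, …)` is the `R(T)`-linear substitution.
The coefficient of `y ^ m` in `f(1, y)` is the sum over `j` of the coefficients in `f` of
`y_1 ^ j` times the shifted monomial `y ^ m`; these infinite sums (for instance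
`∑_j b_i ^ j = (1 - b_i)⁻¹ = e^{a_i}`, giving `σ(Ω(b_i|y)) = e^{a_i} Ω(b_i|y)`) are required to
converge in `R(T)`, in the `(b_1, …, b_n)`-adic topology, to the coefficients of `F`. -/
def IsSigma {n : ℕ} (f F : PS n) : Prop :=
  ∀ m : ℕ →₀ ℕ, ∀ N : ℕ, ∃ J₀ : ℕ, ∀ J ≥ J₀,
    (∑ j ∈ Finset.range J, MvPowerSeries.coeff (consExp j m) f) - MvPowerSeries.coeff m F ∈
      augIdeal n ^ N

end DoubleKSchur

/-!
`σ` commutes with `s_i` for `i ≠ 0`. It multiplies `Ω(b_i|y)` by `e^{a_i}`, so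
`σ ∘ s_0 = e^{-α_0} s_0 ∘ σ`. Hence, if `σ f = e^v F`, then `σ (s_i f) = e^{v - m α_i} s_i F`
where `m` is the pairing of the level-one weight `Λ_0 + v` with the affine coroot `α_i^∨`. If
`m = 1`, then `σ (T_i f) = e^{v - α_i} D_i F`, so along a word all of whose pairings are `1`
(a `Λ_0`-minuscule word) every `T` becomes a `D`. The word of a `k`-small partition is such a word,
and the exponents `-α_i` add up, telescoping along the principal hooks, to the diagonal monomial.
For `(2, 1)` and `n = 3` the last pairing is `2`, which produces one extra term.
-/

namespace DoubleKSchur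

open Filter Topology MvPowerSeries
open scoped MvPowerSeries.WithPiTopology

/-! ### Adic convergence -/

section Adic

variable {R : Type*} [CommRing R] [TopologicalSpace R] [IsTopologicalRing R] {I : Ideal R}

theorem t2Space_of_isAdic [IsNoetherianRing R] [IsDomain R] (hI : IsAdic I) (hI' : I ≠ ⊤) :
    T2Space R := by
  refine IsTopologicalAddGroup.t2Space_of_zero_sep fun x hx => ?_
  obtain ⟨N, hN⟩ : ∃ N, x ∉ I ^ N := by
    by_contra! h
    exact hx (by simpa [Ideal.iInf_pow_eq_bot_of_isDomain I hI'] using Ideal.mem_iInf.2 h)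
  exact ⟨_, hI.hasBasis_nhds_zero.mem_of_mem (i := N) trivial, hN⟩

/-- The Artin–Rees lemma: division by `c` costs a bounded amount of adic precision. -/
theorem isInducing_mul_left_of_isAdic [IsNoetherianRing R] (hI : IsAdic I) {c : R}
    (hc : c ∈ nonZeroDivisors R) : IsInducing (c * ·) := by
  refine (IsTopologicalAddGroup.isInducing_iff_nhds_zero (f := AddMonoidHom.mulLeft c)).2 <|
    le_antisymm ?_ ?_
  · exact (((continuous_const_mul c).tendsto' 0 0 (mul_zero c)).le_comap :)
  · obtain ⟨k, hk⟩ := Ideal.exists_pow_inf_eq_pow_smul I (Ideal.span {c})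
    refine hI.hasBasis_nhds_zero.ge_iff.2 fun N _ => ?_
    refine mem_comap.2 ⟨_, hI.hasBasis_nhds_zero.mem_of_mem (i := N + k) trivial, fun x hx => ?_⟩
    have hcx : c * x ∈ I ^ N * Ideal.span {c} := by
      have h := hk (N + k) (Nat.le_add_left k N)
      rw [Nat.add_sub_cancel, smul_eq_mul, smul_eq_mul, Ideal.mul_top] at h
      exact Ideal.mul_mono_right inf_le_right
        (h.le ⟨hx, Ideal.mem_span_singleton_self c |> Ideal.mul_mem_right x _⟩)
    obtain ⟨z, hz, hzx⟩ := Ideal.mem_mul_span_singleton.1 hcx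
    rwa [SetLike.mem_coe, ← (mul_cancel_right_mem_nonZeroDivisors hc).1 (hzx.trans (mul_comm c x))]

theorem tendsto_iff_of_isAdic (hI : IsAdic I) {ι : Type*} {l : Filter ι} {u : ι → R} {U : R} :
    Tendsto u l (𝓝 U) ↔ ∀ N, ∀ᶠ J in l, u J - U ∈ I ^ N := by
  rw [← tendsto_sub_nhds_zero_iff, hI.hasBasis_nhds_zero.tendsto_right_iff]
  simp

theorem tendsto_of_recurrence (hI : IsAdic I) {c e : R} (hc : c ∈ I) (he : (1 - c) * e = 1)
    {u w : ℕ → R} {U : R} (hw : ∀ J, w (J + 1) = u (J + 1) + c * w J)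
    (hu : Tendsto u atTop (𝓝 U)) : Tendsto w atTop (𝓝 (e * U)) := by
  rw [tendsto_iff_of_isAdic hI] at hu ⊢
  intro N
  induction N with
  | zero => simp
  | succ N ih =>
    rw [← map_add_atTop_eq_nat 1, eventually_map]
    filter_upwards [ih, (tendsto_add_atTop_nat 1).eventually (hu (N + 1))] with J hw_J hu_J
    have hc_mul : c * (w J - e * U) ∈ I ^ (N + 1) := pow_succ' I N ▸ Ideal.mul_mem_mul hc hw_J
    have hrec : w (J + 1) - e * U = (u (J + 1) - U) + c * (w J - e * U) := by
      linear_combination hw J - U * he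
    exact hrec ▸ add_mem hu_J hc_mul

end Adic

section PowerSeriesTopology

variable {σ : Type*} {R : Type*} [Semiring R] [TopologicalSpace R]

theorem continuous_map {S : Type*} [Semiring S] [TopologicalSpace S] {φ : R →+* S}
    (hφ : Continuous φ) : Continuous (MvPowerSeries.map (σ := σ) φ) :=
  continuous_pi fun m => hφ.comp (WithPiTopology.continuous_coeff R m)

theorem isInducing_C_mul {c : R} (hc : IsInducing (c * ·)) :
    IsInducing fun f : MvPowerSeries σ R => C c * f := by
  have hpi : (fun f : MvPowerSeries σ R => C c * f) =
      Pi.map (fun _ : σ →₀ ℕ => (c * · : R → R)) := by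
    ext f m
    exact coeff_C_mul m f c
  exact hpi ▸ IsInducing.piMap fun _ => hc

end PowerSeriesTopology

/-! ### The first variable -/

section FirstVariable

variable {R : Type*} [CommSemiring R]

/-- The bijection `0 ↦ none`, `i + 1 ↦ some i`. -/
def natEquivOption : ℕ ≃ Option ℕ :=
  Equiv.natEquivNatSumPUnit.trans (Equiv.optionEquivSumPUnit.{0} ℕ).symm

/-- Series in `y_0, y_1, …` as series in `y_0` whose coefficients are series in the remaining
variables, renumbered from `0`. -/
noncomputable def firstVarEquiv (R : Type*) [CommSemiring R] :
    MvPowerSeries ℕ R ≃ₐ[R] PowerSeries (MvPowerSeries ℕ R) :=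
  (renameEquiv R natEquivOption).trans (optionEquivLeft ℕ R)

theorem embDomain_consExp (j : ℕ) (m : ℕ →₀ ℕ) :
    (consExp j m).embDomain natEquivOption.toEmbedding = m.optionElim j := by
  ext o
  obtain ⟨i, rfl⟩ := natEquivOption.surjective o
  rw [← Equiv.coe_toEmbedding, Finsupp.embDomain_apply_self]
  cases i with
  | zero =>
    rw [consExp, Finsupp.add_apply, Finsupp.mapDomain_of_notMem_range _ _ (by simp)]
    exact (Finsupp.single_eq_same.trans (Finsupp.optionElim_apply_none j m).symm :)
  | succ i =>
    rw [consExp, Finsupp.add_apply, Finsupp.mapDomain_apply Nat.succ_injective,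
      Finsupp.single_eq_of_ne i.succ_ne_zero, zero_add]
    exact (Finsupp.optionElim_apply_some j m i).symm

theorem coeff_coeff_firstVarEquiv (f : MvPowerSeries ℕ R) (j : ℕ) (m : ℕ →₀ ℕ) :
    coeff m (PowerSeries.coeff j (firstVarEquiv R f)) = coeff (consExp j m) f := by
  rw [← coeff_embDomain_rename (R := R) natEquivOption.toEmbedding f, embDomain_consExp]
  exact coeff_coeff_optionEquivLeft (rename natEquivOption f) j m

/-- The sum of the coefficients of `y_0 ^ j`, `j < J`, of a series in `y_0, y_1, …`; the
substitution `σ` is its limit for `J → ∞`. -/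
noncomputable def firstVarPartialSum (f : MvPowerSeries ℕ R) (J : ℕ) : MvPowerSeries ℕ R :=
  ∑ j ∈ Finset.range J, PowerSeries.coeff j (firstVarEquiv R f)

theorem coeff_firstVarPartialSum (f : MvPowerSeries ℕ R) (J : ℕ) (m : ℕ →₀ ℕ) :
    coeff m (firstVarPartialSum f J) = ∑ j ∈ Finset.range J, coeff (consExp j m) f := by
  simp only [firstVarPartialSum, map_sum, coeff_coeff_firstVarEquiv]

theorem firstVarPartialSum_sub {R : Type*} [CommRing R] (f f' : MvPowerSeries ℕ R) (J : ℕ) :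
    firstVarPartialSum (f - f') J = firstVarPartialSum f J - firstVarPartialSum f' J := by
  simp only [firstVarPartialSum, map_sub, Finset.sum_sub_distrib]

theorem firstVarPartialSum_C_mul (c : R) (f : MvPowerSeries ℕ R) (J : ℕ) :
    firstVarPartialSum (C c * f) J = C c * firstVarPartialSum f J := by
  ext m
  simp only [coeff_firstVarPartialSum, coeff_C_mul, Finset.mul_sum]

theorem firstVarPartialSum_map {S : Type*} [CommSemiring S] (φ : R →+* S) (f : MvPowerSeries ℕ R)
    (J : ℕ) : firstVarPartialSum (MvPowerSeries.map φ f) J =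
      MvPowerSeries.map φ (firstVarPartialSum f J) := by
  ext m
  simp only [coeff_firstVarPartialSum, coeff_map, map_sum]

theorem firstVarPartialSum_one_succ (J : ℕ) :
    firstVarPartialSum (1 : MvPowerSeries ℕ R) (J + 1) = 1 := by
  simp [firstVarPartialSum, PowerSeries.coeff_one]

theorem firstVarPartialSum_succ_of_eq_add_X_mul {f u v : MvPowerSeries ℕ R} {c : R}
    (h : firstVarEquiv R f = PowerSeries.C u * firstVarEquiv R v +
      PowerSeries.C (C c) * (PowerSeries.X * firstVarEquiv R f)) (J : ℕ) :
    firstVarPartialSum f (J + 1) =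
      u * firstVarPartialSum v (J + 1) + C c * firstVarPartialSum f J := by
  rw [firstVarPartialSum, h]
  simp only [map_add, PowerSeries.coeff_C_mul, Finset.sum_add_distrib, ← Finset.mul_sum,
    Finset.sum_range_succ' (fun j => PowerSeries.coeff j (PowerSeries.X * _)) J,
    PowerSeries.coeff_succ_X_mul, PowerSeries.coeff_zero_X_mul, add_zero]
  rfl

end FirstVariable

/-! ### The Cauchy kernel -/

section Omega

variable {n : ℕ} (c : RT n)

theorem degree_consExp (j : ℕ) (m : ℕ →₀ ℕ) : (consExp j m).degree = j + m.degree := by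
  rw [consExp, map_add, Finsupp.degree_single, Finsupp.degree_mapDomain]

theorem coeff_Omega (m : ℕ →₀ ℕ) : coeff m (Omega c) = c ^ m.degree := rfl

theorem constantCoeff_Omega : constantCoeff (Omega c) = 1 := by
  rw [← coeff_zero_eq_constantCoeff_apply, coeff_Omega, map_zero, pow_zero]

theorem Omega_mul_invOfUnit : Omega c * invOfUnit (Omega c) 1 = 1 :=
  mul_invOfUnit _ _ (constantCoeff_Omega c)

theorem firstVarEquiv_Omega :
    firstVarEquiv (RT n) (Omega c) = PowerSeries.C (Omega c) +
      PowerSeries.C (C c) * (PowerSeries.X * firstVarEquiv (RT n) (Omega c)) := by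
  ext j m
  rw [map_add, map_add, PowerSeries.coeff_C_mul, coeff_C_mul, coeff_coeff_firstVarEquiv]
  cases j with
  | zero => simp [coeff_Omega, degree_consExp]
  | succ j =>
    rw [PowerSeries.coeff_succ_X_mul, coeff_coeff_firstVarEquiv, PowerSeries.coeff_succ_C,
      map_zero, zero_add, coeff_Omega, coeff_Omega, degree_consExp, degree_consExp, ← pow_succ',
      add_right_comm]

theorem firstVarPartialSum_Omega_mul (f : PS n) (J : ℕ) :
    firstVarPartialSum (Omega c * f) (J + 1) =
      Omega c * firstVarPartialSum f (J + 1) + C c * firstVarPartialSum (Omega c * f) J := by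
  apply firstVarPartialSum_succ_of_eq_add_X_mul
  rw [map_mul]
  linear_combination firstVarEquiv (RT n) f * firstVarEquiv_Omega c

end Omega

/-! ### The representation ring -/

theorem reflRT_ex (n : ℕ) (i : ZMod n) (v : CharLattice n) :
    reflRT n i (ex v) = ex (reflChar n i v) := by
  simp [reflRT, ex]

theorem ex_mul_ex_neg {n : ℕ} (v : CharLattice n) : ex v * ex (-v) = 1 := by
  rw [← ex_add, add_neg_cancel, ex_zero]

theorem ex_sum {n : ℕ} {ι : Type*} (s : Finset ι) (v : ι → CharLattice n) :
    ex (∑ x ∈ s, v x) = ∏ x ∈ s, ex (v x) :=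
  map_prod (AddMonoidAlgebra.of ℤ (CharLattice n)) (fun x => Multiplicative.ofAdd (v x)) s

theorem ex_injective (n : ℕ) : Function.Injective (ex : CharLattice n → RT n) :=
  AddMonoidAlgebra.of_injective

instance isNoetherianRing_RT (n : ℕ) [NeZero n] : IsNoetherianRing (RT n) := by
  have : Module.Finite ℤ (CharLattice n) :=
    Module.Finite.of_surjective
      ((QuotientAddGroup.mk' (AddSubgroup.zmultiples (fun _ => 1 : ZMod n → ℤ))).toIntLinearMap)
      (QuotientAddGroup.mk'_surjective _)
  have : AddMonoid.FG (CharLattice n) :=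
    AddGroup.fg_iff_addMonoid_fg.1 (Module.Finite.iff_addGroup_fg.1 this)
  exact Algebra.FiniteType.isNoetherianRing ℤ (RT n)

section Coroot

variable (n : ℕ) (i : ZMod n)

/-- The simple coroot `α_i^∨` as a functional on characters; for `i = 0` it is `-θ^∨`. -/
def coroot : CharLattice n →+ ℤ :=
  QuotientAddGroup.lift _
    (Pi.evalAddMonoidHom (fun _ => ℤ) i - Pi.evalAddMonoidHom (fun _ => ℤ) (i + 1)) <| by
    simp [AddSubgroup.zmultiples_le]

theorem coroot_a (j : ZMod n) :
    coroot n i (a n j) = (if i = j then 1 else 0) - if i + 1 = j then 1 else 0 := by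
  rw [← Pi.single_apply, ← Pi.single_apply]
  rfl

theorem reflChar_eq_sub_coroot_smul (v : CharLattice n) :
    reflChar n i v = v - coroot n i v • simpleRoot n i := by
  induction v using QuotientAddGroup.induction_on with
  | H v =>
    change QuotientAddGroup.mk _ = QuotientAddGroup.mk
      (v - (v i - v (i + 1)) • (Pi.single i 1 - Pi.single (i + 1) 1))
    congr 1
    funext j
    by_cases h : i = i + 1
    · simp [← h]
    · rcases eq_or_ne j i with rfl | hi
      · simp [h]
      · rcases eq_or_ne j (i + 1) with rfl | hi'
        · simp [Ne.symm h]
        · simp [Equiv.swap_apply_of_ne_of_ne hi hi', hi, hi']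

theorem reflChar_a (j : ZMod n) : reflChar n i (a n j) = a n (Equiv.swap i (i + 1) j) := by
  change QuotientAddGroup.mk _ = QuotientAddGroup.mk _
  congr 1
  funext l
  change (Pi.single j 1 : ZMod n → ℤ) (Equiv.swap i (i + 1) l) = _
  simp only [Pi.single_apply, Equiv.swap_apply_eq_iff]

theorem reflRT_b (j : ZMod n) : reflRT n i (b n j) = b n (Equiv.swap i (i + 1) j) := by
  rw [b, map_sub, map_one, reflRT_ex, map_neg, reflChar_a, b]

variable {n}

theorem coroot_simpleRoot (hn : 2 ≤ n) : coroot n i (simpleRoot n i) = 2 := by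
  have : Fact (1 < n) := ⟨hn⟩
  simp [simpleRoot, coroot_a]

theorem one_sub_ex_simpleRoot_ne_zero (hn : 2 ≤ n) : (1 - ex (simpleRoot n i) : RT n) ≠ 0 := by
  intro h
  have hroot : simpleRoot n i = 0 := ex_injective n (sub_eq_zero.1 h).symm
  simpa [hroot] using coroot_simpleRoot i hn

end Coroot

/-! ### Properties of `σ` -/

theorem augIdeal_ne_top (n : ℕ) : augIdeal n ≠ ⊤ := by
  let ε : RT n →ₐ[ℤ] ℤ := AddMonoidAlgebra.lift ℤ ℤ (CharLattice n) 1
  have hle : augIdeal n ≤ RingHom.ker ε := by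
    rw [augIdeal, Ideal.span_le]
    rintro _ ⟨i, rfl⟩
    simp [RingHom.mem_ker, b, ex, ε]
  exact ne_top_of_le_ne_top (RingHom.ker_ne_top ε) hle

theorem b_mem_augIdeal (n : ℕ) (i : ZMod n) : b n i ∈ augIdeal n :=
  Ideal.subset_span ⟨i, rfl⟩

noncomputable instance (n : ℕ) : WithIdeal (RT n) := ⟨augIdeal n⟩

theorem isAdic_augIdeal (n : ℕ) : IsAdic (augIdeal n) := rfl

instance (n : ℕ) [NeZero n] : T2Space (RT n) :=
  t2Space_of_isAdic (isAdic_augIdeal n) (augIdeal_ne_top n)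

theorem continuous_reflRT (n : ℕ) (i : ZMod n) : Continuous (reflRT n i) := by
  refine (WithIdeal.uniformContinuous_of_map_le ?_).continuous
  change (Ideal.span (Set.range (b n))).map _ ≤ _
  rw [Ideal.map_le_iff_le_comap, Ideal.span_le]
  rintro _ ⟨j, rfl⟩
  rw [SetLike.mem_coe, Ideal.mem_comap, reflRT_b]
  exact b_mem_augIdeal n _

theorem isSigma_iff_tendsto {n : ℕ} (f F : PS n) :
    IsSigma f F ↔ Tendsto (firstVarPartialSum f) atTop (𝓝 F) := by
  simp only [WithPiTopology.tendsto_iff_coeff_tendsto, tendsto_iff_of_isAdic (isAdic_augIdeal n),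
    coeff_firstVarPartialSum, eventually_atTop, IsSigma]

theorem one_sub_b_mul_ex (n : ℕ) (i : ZMod n) : (1 - b n i) * ex (a n i) = 1 := by
  rw [b, sub_sub_cancel, mul_comm, ex_mul_ex_neg]

namespace IsSigma

variable {n : ℕ} {f f' F F' : PS n}

theorem one : IsSigma (1 : PS n) 1 := by
  rw [isSigma_iff_tendsto, ← tendsto_add_atTop_iff_nat 1]
  simp only [firstVarPartialSum_one_succ, tendsto_const_nhds]

theorem unique [NeZero n] (h : IsSigma f F) (h' : IsSigma f F') : F = F' :=
  tendsto_nhds_unique ((isSigma_iff_tendsto f F).1 h) ((isSigma_iff_tendsto f F').1 h')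

theorem iff_eq [NeZero n] (h : IsSigma f F) : IsSigma f F' ↔ F' = F :=
  ⟨fun h' => h'.unique h, fun heq => heq ▸ h⟩

theorem sub (h : IsSigma f F) (h' : IsSigma f' F') : IsSigma (f - f') (F - F') := by
  rw [isSigma_iff_tendsto] at *
  simpa only [← firstVarPartialSum_sub] using h.sub h'

theorem map_reflRT (i : ZMod n) (h : IsSigma f F) :
    IsSigma (MvPowerSeries.map (reflRT n i) f) (MvPowerSeries.map (reflRT n i) F) := by
  rw [isSigma_iff_tendsto] at *
  simpa only [← firstVarPartialSum_map, Function.comp_def] using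
    ((continuous_map (continuous_reflRT n i)).tendsto F).comp h

theorem of_C_mul [NeZero n] {c : RT n} (hc : c ≠ 0) (h : IsSigma (C c * f) (C c * F)) :
    IsSigma f F := by
  rw [isSigma_iff_tendsto] at *
  have hind := isInducing_C_mul (σ := ℕ)
    (isInducing_mul_left_of_isAdic (isAdic_augIdeal n) (mem_nonZeroDivisors_of_ne_zero hc))
  exact hind.tendsto_nhds_iff.2 (h.congr fun J => firstVarPartialSum_C_mul ..)

theorem Omega_b_mul (i : ZMod n) (h : IsSigma f F) :
    IsSigma (Omega (b n i) * f) (C (ex (a n i)) * (Omega (b n i) * F)) := by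
  rw [isSigma_iff_tendsto] at *
  have hmul := h.const_mul (Omega (b n i))
  rw [WithPiTopology.tendsto_iff_coeff_tendsto] at hmul ⊢
  intro m
  rw [coeff_C_mul]
  refine tendsto_of_recurrence (isAdic_augIdeal n) (b_mem_augIdeal n i) (one_sub_b_mul_ex n i)
    (fun J => ?_) (hmul m)
  rw [firstVarPartialSum_Omega_mul, map_add, coeff_C_mul]

theorem of_Omega_mul {c : RT n} (h : IsSigma (Omega c * f) F) :
    IsSigma f (invOfUnit (Omega c) 1 * (F - C c * F)) := by
  rw [isSigma_iff_tendsto] at *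
  rw [← tendsto_add_atTop_iff_nat 1]
  refine ((((tendsto_add_atTop_iff_nat 1).2 h).sub (h.const_mul (C c))).const_mul _).congr
    fun J => ?_
  rw [firstVarPartialSum_Omega_mul, add_sub_cancel_right, ← mul_assoc, mul_comm (invOfUnit _ _),
    Omega_mul_invOfUnit, one_mul]

end IsSigma

/-! ### `σ` and the Demazure operators -/

section Reflection

variable {n : ℕ} {i : ZMod n}

theorem refl_of_ne_zero (hi : i ≠ 0) (f : PS n) :
    refl n i f = MvPowerSeries.map (reflRT n i) f :=
  if_neg hi

theorem refl_zero (f : PS n) :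
    refl n 0 f =
      Omega (b n 1) * invOfUnit (Omega (b n 0)) 1 * MvPowerSeries.map (reflRT n 0) f :=
  if_pos rfl

theorem Omega_mul_refl_zero (f : PS n) :
    Omega (b n 0) * refl n 0 f = Omega (b n 1) * MvPowerSeries.map (reflRT n 0) f := by
  rw [refl_zero]
  linear_combination (Omega (b n 1) * MvPowerSeries.map (reflRT n 0) f) *
    Omega_mul_invOfUnit (b n 0)

theorem refl_C_ex_mul (i : ZMod n) (v : CharLattice n) (f : PS n) :
    refl n i (C (ex v) * f) = C (ex (reflChar n i v)) * refl n i f := by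
  rcases eq_or_ne i 0 with rfl | hi
  · rw [refl_zero, refl_zero, map_mul, map_C, reflRT_ex]
    ring
  · rw [refl_of_ne_zero hi, refl_of_ne_zero hi, map_mul, map_C, reflRT_ex]

theorem C_mul_D (i : ZMod n) (f : PS n) :
    C (1 - ex (simpleRoot n i)) * D n i f = refl n i f - C (ex (simpleRoot n i)) * f := by
  rw [D, mul_add, T_spec, map_sub, map_one]
  ring

end Reflection

namespace IsSigma

variable {n : ℕ} {i : ZMod n} {f F : PS n}

theorem refl_of_ne_zero (hi : i ≠ 0) (h : IsSigma f F) : IsSigma (refl n i f) (refl n i F) := by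
  rw [DoubleKSchur.refl_of_ne_zero hi, DoubleKSchur.refl_of_ne_zero hi]
  exact h.map_reflRT i

theorem refl_zero (h : IsSigma f F) :
    IsSigma (refl n 0 f) (C (ex (-simpleRoot n 0)) * refl n 0 F) := by
  have hOmega := (h.map_reflRT 0).Omega_b_mul 1
  rw [← Omega_mul_refl_zero] at hOmega
  have hex : ex (-simpleRoot n 0) = ex (a n 1) * (1 - b n 0) := by
    rw [b, sub_sub_cancel, ← ex_add, simpleRoot, zero_add, neg_sub, sub_eq_add_neg]
  convert hOmega.of_Omega_mul using 1
  rw [DoubleKSchur.refl_zero, hex, map_mul, map_sub, map_one]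
  ring

end IsSigma

/-- The pairing `⟨Λ₀ + v, α_i^∨⟩` of the `i`-th affine coroot with a weight of level one: the
central element only contributes to `α_0^∨`. -/
def levelOnePairing (n : ℕ) (i : ZMod n) (v : CharLattice n) : ℤ :=
  (if i = 0 then 1 else 0) + coroot n i v

namespace IsSigma

variable {n : ℕ} {f F : PS n} {v : CharLattice n}

/-- Both cases say that `σ` turns `s_i` into its action on characters of level one, which is why
`e^v` moves by the level-one pairing. -/
theorem refl_of_C_ex_mul (i : ZMod n) (h : IsSigma f (C (ex v) * F)) :
    IsSigma (refl n i f)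
      (C (ex (v - levelOnePairing n i v • simpleRoot n i)) * refl n i F) := by
  rcases eq_or_ne i 0 with rfl | hi
  · have hv : v - levelOnePairing n 0 v • simpleRoot n 0 =
        -simpleRoot n 0 + reflChar n 0 v := by
      rw [levelOnePairing, if_pos rfl, reflChar_eq_sub_coroot_smul, add_zsmul, one_zsmul]
      abel
    rw [hv, ex_add, map_mul, mul_assoc, ← refl_C_ex_mul]
    exact h.refl_zero
  · have hv : v - levelOnePairing n i v • simpleRoot n i = reflChar n i v := by
      rw [levelOnePairing, if_neg hi, zero_add, reflChar_eq_sub_coroot_smul]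
    rw [hv, ← refl_C_ex_mul]
    exact h.refl_of_ne_zero hi

theorem T_of_levelOnePairing_eq {i : ZMod n} {m : ℕ} (hn : 2 ≤ n) (h : IsSigma f (C (ex v) * F))
    (hv : levelOnePairing n i v = m + 1) :
    IsSigma (T n i f) (C (ex (v - (m + 1) • simpleRoot n i)) * D n i F +
      C (∑ j ∈ Finset.range m, ex (v - (j + 1) • simpleRoot n i)) * F) := by
  have : NeZero n := ⟨by lia⟩
  set α := simpleRoot n i with hα
  have hstep : ∀ j : ℕ, ex α * ex (v - (j + 1) • α) = ex (v - j • α) := fun j => by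
    rw [← ex_add, succ_nsmul]
    congr 1
    abel
  have hgeom : (1 - ex α) * ∑ j ∈ Finset.range m, ex (v - (j + 1) • α) =
      ex (v - m • α) - ex v := by
    have htele := Finset.sum_range_sub (fun j : ℕ => ex (v - j • α)) m
    rw [zero_nsmul, sub_zero] at htele
    simp only [Finset.mul_sum, sub_mul, one_mul, hstep, htele]
  refine IsSigma.of_C_mul (one_sub_ex_simpleRoot_ne_zero i hn) ?_
  rw [T_spec]
  convert (h.refl_of_C_ex_mul i).sub h using 1
  have hC := congrArg (C (σ := ℕ)) hgeom
  have hCstep := congrArg (C (σ := ℕ)) (hstep m)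
  have hD := C_mul_D i F
  rw [← hα] at hD
  rw [hv, ← hα, ← Nat.cast_succ, natCast_zsmul]
  simp only [map_mul, map_sub] at hC hCstep hD ⊢
  linear_combination C (ex (v - (m + 1) • α)) * hD + F * hC - F * hCstep

end IsSigma

/-- The finite part of `s_{i_1} ⋯ s_{i_l} Λ₀ - Λ₀` when the word `i_1, …, i_l` is
`Λ₀`-minuscule. -/
def wordWeight (n : ℕ) (w : List (ZMod n)) : CharLattice n :=
  -(w.map (simpleRoot n)).sum

/-- `Λ₀`-minuscule words in the sense of Peterson: read from the right, each simple reflection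
lowers the weight it is applied to by exactly one simple root. -/
def IsMinusculeWord (n : ℕ) : List (ZMod n) → Prop
  | [] => True
  | i :: w => IsMinusculeWord n w ∧ levelOnePairing n i (wordWeight n w) = 1

theorem wordWeight_nil (n : ℕ) : wordWeight n [] = 0 :=
  neg_zero

theorem wordWeight_append (n : ℕ) (w w' : List (ZMod n)) :
    wordWeight n (w ++ w') = wordWeight n w + wordWeight n w' := by
  simp only [wordWeight, List.map_append, List.sum_append, neg_add]

theorem wordWeight_cons (n : ℕ) (i : ZMod n) (w : List (ZMod n)) :
    wordWeight n (i :: w) = wordWeight n w - simpleRoot n i := by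
  rw [wordWeight, List.map_cons, List.sum_cons, neg_add_rev, ← sub_eq_add_neg, wordWeight]

theorem IsMinusculeWord.isSigma_foldr_T {n : ℕ} (hn : 2 ≤ n) :
    ∀ {w : List (ZMod n)}, IsMinusculeWord n w →
      IsSigma (w.foldr (T n) 1) (C (ex (wordWeight n w)) * w.foldr (D n) 1)
  | [], _ => by
    simpa only [wordWeight_nil, ex_zero, map_one, one_mul, List.foldr_nil] using IsSigma.one
  | i :: w, ⟨hw, hi⟩ => by
    simpa only [wordWeight_cons, List.foldr_cons, zero_add, one_smul, Finset.range_zero,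
      Finset.sum_empty, map_zero, zero_mul, add_zero] using
      IsSigma.T_of_levelOnePairing_eq (m := 0) hn (hw.isSigma_foldr_T hn) (by simpa using hi)

/-! ### Words of `k`-small partitions -/

section CorootPairing

variable {n : ℕ}

theorem natCast_ne_zero_of_lt {k : ℕ} (hk : 0 < k) (hkn : k < n) : (k : ZMod n) ≠ 0 := by
  rw [Ne, ZMod.natCast_eq_zero_iff]
  exact Nat.not_dvd_of_pos_of_lt hk hkn

theorem coroot_a_self (hn : 2 ≤ n) (r : ZMod n) : coroot n r (a n r) = 1 := by
  have : Fact (1 < n) := ⟨hn⟩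
  simp [coroot_a]

theorem coroot_a_add_natCast {k : ℕ} (hk : 2 ≤ k) (hkn : k < n) (r : ZMod n) :
    coroot n r (a n (r + k)) = 0 := by
  obtain ⟨k, rfl⟩ := Nat.exists_eq_add_of_le' (Nat.le_of_succ_le hk)
  have h₀ : ((k + 1 : ℕ) : ZMod n) ≠ 0 := natCast_ne_zero_of_lt k.succ_pos hkn
  have h₁ : (k : ZMod n) ≠ 0 := natCast_ne_zero_of_lt (by lia) (by lia)
  have h : r + ((k + 1 : ℕ) : ZMod n) = r + 1 + k := by push_cast; ring
  rw [coroot_a, if_neg fun e => h₀ (left_eq_add.1 e), h, if_neg fun e => h₁ (left_eq_add.1 e),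
    sub_zero]

theorem sum_coroot_a_res_zero (r : ZMod n) (i : ℕ) :
    ∑ p ∈ Finset.range i, coroot n r (a n (res n p 0)) =
      (if r = 0 then 1 else 0) - if r = res n i 0 then 1 else 0 := by
  have h : ∀ p, coroot n r (a n (res n p 0)) =
      (if r = res n p 0 then 1 else 0) - if r = res n (p + 1) 0 then 1 else 0 := fun p => by
    rw [coroot_a, show res n (p + 1) 0 = res n p 0 - 1 by simp only [res]; push_cast; ring]
    simp only [eq_sub_iff_add_eq]
  simp only [h, Finset.sum_range_sub']
  simp [res]

end CorootPairing

/-- The residues of the first `j` boxes of row `i`, read from right to left. -/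
def rowWord (n i j : ℕ) : List (ZMod n) :=
  ((List.range j).map (res n i)).reverse

/-- The part of `redWord n lam` coming from the first `i` rows. -/
def rowsWord (n : ℕ) (lam : YoungDiagram) (i : ℕ) : List (ZMod n) :=
  ((List.range i).flatMap fun p => (List.range (lam.rowLen p)).map (res n p)).reverse

section Words

variable (n : ℕ) (lam : YoungDiagram) (i j : ℕ)

theorem rowWord_succ : rowWord n i (j + 1) = res n i j :: rowWord n i j := by
  simp only [rowWord, List.range_succ, List.map_append, List.map_cons, List.map_nil,
    List.reverse_append, List.reverse_singleton, List.singleton_append]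

theorem rowsWord_succ :
    rowsWord n lam (i + 1) = rowWord n i (lam.rowLen i) ++ rowsWord n lam i := by
  simp only [rowsWord, rowWord, List.range_succ, List.flatMap_append, List.flatMap_singleton,
    List.reverse_append]

theorem res_succ_right : res n i (j + 1) = res n i j + 1 := by
  simp only [res, Nat.cast_succ]
  ring

theorem res_succ_left_add_one : res n (i + 1) j + 1 = res n i j := by
  simp only [res, Nat.cast_succ]
  ring

theorem wordWeight_rowWord :
    wordWeight n (rowWord n i j) = a n (res n i j) - a n (res n i 0) := by
  induction j with
  | zero => rw [sub_self]; exact wordWeight_nil n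
  | succ j ih =>
    rw [rowWord_succ, wordWeight_cons, ih, simpleRoot, ← res_succ_right]
    abel

theorem wordWeight_rowsWord :
    wordWeight n (rowsWord n lam i) =
      ∑ p ∈ Finset.range i, (a n (res n p (lam.rowLen p)) - a n (res n p 0)) := by
  induction i with
  | zero => exact wordWeight_nil n
  | succ i ih =>
    rw [rowsWord_succ, wordWeight_append, ih, wordWeight_rowWord, Finset.sum_range_succ, add_comm]

end Words

section Small

variable {n : ℕ} {lam : YoungDiagram} {i j : ℕ}

/-- The ends of the earlier rows are orthogonal to the coroot; the row beginnings telescope and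
cancel the contribution of `Λ₀`; only the end of the current row is left. -/
theorem levelOnePairing_rowWord_append (hsmall : lam.rowLen 0 + lam.colLen 0 ≤ n)
    (hij : (i, j) ∈ lam) :
    levelOnePairing n (res n i j) (wordWeight n (rowWord n i j ++ rowsWord n lam i)) = 1 := by
  have hj : j < lam.rowLen i := YoungDiagram.mem_iff_lt_rowLen.1 hij
  have hi : i < lam.colLen 0 :=
    YoungDiagram.mem_iff_lt_colLen.1 (lam.up_left_mem le_rfl j.zero_le hij)
  have hrow : lam.rowLen i ≤ lam.rowLen 0 := lam.rowLen_anti 0 i i.zero_le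
  have hends : ∀ p ∈ Finset.range i,
      coroot n (res n i j) (a n (res n p (lam.rowLen p))) = 0 := fun p hp => by
    have hp : p < i := Finset.mem_range.1 hp
    have hpi : lam.rowLen i ≤ lam.rowLen p := lam.rowLen_anti p i hp.le
    have hp0 : lam.rowLen p ≤ lam.rowLen 0 := lam.rowLen_anti 0 p p.zero_le
    obtain ⟨k, hk⟩ := Nat.exists_eq_add_of_le (show j + p ≤ lam.rowLen p + i by lia)
    have hres : res n p (lam.rowLen p) = res n i j + k := by
      have := congrArg (Nat.cast : ℕ → ZMod n) hk
      push_cast at this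
      simp only [res]
      linear_combination this
    rw [hres, coroot_a_add_natCast (by lia) (by lia)]
  have hstart : res n i j ≠ res n (i + 1) 0 := fun h => by
    refine natCast_ne_zero_of_lt (n := n) j.succ_pos (by lia) ?_
    simp only [res, Nat.cast_succ, Nat.cast_zero] at h ⊢
    linear_combination h
  have hsum := sum_coroot_a_res_zero (res n i j) (i + 1)
  rw [if_neg hstart, Finset.sum_range_succ] at hsum
  rw [levelOnePairing, wordWeight_append, wordWeight_rowWord, wordWeight_rowsWord]
  simp only [map_add, map_sub, map_sum, Finset.sum_sub_distrib, Finset.sum_eq_zero hends,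
    coroot_a_self (show 2 ≤ n by lia)]
  lia

theorem isMinusculeWord_rowWord_append (hsmall : lam.rowLen 0 + lam.colLen 0 ≤ n)
    (hj : j ≤ lam.rowLen i) (hrows : IsMinusculeWord n (rowsWord n lam i)) :
    IsMinusculeWord n (rowWord n i j ++ rowsWord n lam i) := by
  induction j with
  | zero => exact hrows
  | succ j ih =>
    rw [rowWord_succ]
    exact ⟨ih (Nat.le_of_succ_le hj),
      levelOnePairing_rowWord_append hsmall (YoungDiagram.mem_iff_lt_rowLen.2 hj)⟩

theorem isMinusculeWord_redWord (hsmall : lam.rowLen 0 + lam.colLen 0 ≤ n) :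
    IsMinusculeWord n (redWord n lam) := by
  suffices h : ∀ i, IsMinusculeWord n (rowsWord n lam i) from h (lam.colLen 0)
  intro i
  induction i with
  | zero => trivial
  | succ i ih =>
    rw [rowsWord_succ]
    exact isMinusculeWord_rowWord_append hsmall le_rfl ih

end Small

section Hooks

variable {M : Type*} [AddCommMonoid M] (lam : YoungDiagram) (f : ℕ × ℕ → M)

theorem sum_cells_eq_sum_rows :
    ∑ c ∈ lam.cells, f c =
      ∑ i ∈ Finset.range (lam.colLen 0), ∑ j ∈ Finset.range (lam.rowLen i), f (i, j) := by
  refine Finset.sum_finset_product _ _ _ fun ⟨i, j⟩ => ?_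
  simp only [YoungDiagram.mem_cells, Finset.mem_range, ← YoungDiagram.mem_iff_lt_colLen,
    ← YoungDiagram.mem_iff_lt_rowLen]
  exact ⟨fun h => ⟨lam.up_left_mem le_rfl j.zero_le h, h⟩, And.right⟩

theorem sum_arms_eq_sum_diag :
    ∑ c ∈ lam.cells with c.1 ≤ c.2, f c =
      ∑ x ∈ lam.cells with x.1 = x.2, ∑ j ∈ Finset.Ico x.1 (lam.rowLen x.1), f (x.1, j) := by
  rw [Finset.sum_sigma']
  refine Finset.sum_nbij' (fun c => ⟨(c.1, c.1), c.2⟩) (fun s => (s.1.1, s.2)) ?_ ?_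
    (fun _ _ => rfl) ?_ fun _ _ => rfl
  · rintro ⟨i, j⟩ h
    simp only [Finset.mem_filter, YoungDiagram.mem_cells, Finset.mem_sigma, Finset.mem_Ico,
      ← YoungDiagram.mem_iff_lt_rowLen, and_true] at h ⊢
    exact ⟨lam.up_left_mem le_rfl h.2 h.1, h.2, h.1⟩
  · rintro ⟨⟨p, q⟩, j⟩ h
    simp only [Finset.mem_filter, YoungDiagram.mem_cells, Finset.mem_sigma, Finset.mem_Ico,
      ← YoungDiagram.mem_iff_lt_rowLen] at h ⊢
    exact h.2.symm
  · rintro ⟨⟨p, q⟩, j⟩ h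
    obtain rfl : p = q := (Finset.mem_filter.1 (Finset.mem_sigma.1 h).1).2
    rfl

theorem sum_legs_eq_sum_diag :
    ∑ c ∈ lam.cells with ¬ c.1 ≤ c.2, f c =
      ∑ x ∈ lam.cells with x.1 = x.2,
        ∑ i ∈ Finset.Ico x.1 (lam.colLen x.2 - 1), f (i + 1, x.2) := by
  rw [Finset.sum_sigma']
  refine Finset.sum_nbij' (fun c => ⟨(c.2, c.2), c.1 - 1⟩) (fun s => (s.2 + 1, s.1.2)) ?_ ?_ ?_
    ?_ ?_
  · rintro ⟨i, j⟩ h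
    simp only [Finset.mem_filter, YoungDiagram.mem_cells, Finset.mem_sigma, Finset.mem_Ico,
      and_true] at h ⊢
    have hi := YoungDiagram.mem_iff_lt_colLen.1 h.1
    exact ⟨lam.up_left_mem (by lia) le_rfl h.1, by lia, by lia⟩
  · rintro ⟨⟨p, q⟩, i⟩ h
    simp only [Finset.mem_filter, YoungDiagram.mem_cells, Finset.mem_sigma, Finset.mem_Ico] at h ⊢
    exact ⟨YoungDiagram.mem_iff_lt_colLen.2 (by lia), by lia⟩
  · rintro ⟨i, j⟩ h
    have hij := (Finset.mem_filter.1 h).2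
    exact Prod.ext (by lia) rfl
  · rintro ⟨⟨p, q⟩, i⟩ h
    obtain rfl : p = q := (Finset.mem_filter.1 (Finset.mem_sigma.1 h).1).2
    rfl
  · rintro ⟨i, j⟩ h
    have hij := (Finset.mem_filter.1 h).2
    exact congrArg f (Prod.ext (by lia) rfl)

end Hooks

section DiagMonomial

variable (n : ℕ) (lam : YoungDiagram)

theorem wordWeight_redWord_eq_sum_cells :
    wordWeight n (redWord n lam) =
      ∑ c ∈ lam.cells, (a n (res n c.1 c.2 + 1) - a n (res n c.1 c.2)) := by
  rw [sum_cells_eq_sum_rows]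
  refine (wordWeight_rowsWord n lam (lam.colLen 0)).trans (Finset.sum_congr rfl fun i _ => ?_)
  simp only [← res_succ_right, Finset.sum_range_sub fun j => a n (res n i j)]

/-- Along the principal hook of a diagonal box the differences telescope: outwards along the arm
and, since the residue drops by one from each row to the next, also along the leg. -/
theorem wordWeight_redWord :
    wordWeight n (redWord n lam) =
      ∑ x ∈ lam.cells with x.1 = x.2,
        (a n (res n x.1 (lam.rowLen x.1 - 1) + 1) - a n (res n (lam.colLen x.2 - 1) x.2)) := by
  rw [wordWeight_redWord_eq_sum_cells, ← Finset.sum_filter_add_sum_filter_not _ fun c => c.1 ≤ c.2,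
    sum_arms_eq_sum_diag, sum_legs_eq_sum_diag, ← Finset.sum_add_distrib]
  refine Finset.sum_congr rfl fun ⟨p, q⟩ hx => ?_
  obtain ⟨hmem, rfl : p = q⟩ := Finset.mem_filter.1 hx
  have hrow : p < lam.rowLen p := YoungDiagram.mem_iff_lt_rowLen.1 hmem
  have hcol : p < lam.colLen p := YoungDiagram.mem_iff_lt_colLen.1 hmem
  have hleg : ∑ i ∈ Finset.Ico p (lam.colLen p - 1), (a n (res n i p) - a n (res n (i + 1) p)) =
      a n (res n p p) - a n (res n (lam.colLen p - 1) p) := by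
    rw [← neg_inj, ← Finset.sum_neg_distrib]
    simpa only [neg_sub] using
      Finset.sum_Ico_sub (fun i => a n (res n i p)) (Nat.le_sub_one_of_lt hcol)
  simp only [res_succ_left_add_one, ← res_succ_right]
  rw [Finset.sum_Ico_sub (fun j => a n (res n p j)) hrow.le, hleg, Nat.sub_add_cancel (by lia)]
  abel

theorem ex_wordWeight_redWord : ex (wordWeight n (redWord n lam)) = diagMonomial n lam := by
  rw [wordWeight_redWord, ex_sum, diagMonomial]

end DiagMonomial

theorem isSigma_g_of_isKSmall {n : ℕ} (hn : 2 ≤ n) {lam : YoungDiagram}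
    (hlam : IsKSmall n lam) : IsSigma (g n lam) (C (diagMonomial n lam) * gTilde n lam) := by
  rw [← ex_wordWeight_redWord]
  exact (isMinusculeWord_redWord hlam.2).isSigma_foldr_T hn

/-! ### The partition `(2, 1)` for `n = 3` -/

section LowDegree

variable {n : ℕ}

theorem coeff_single_Omega_mul (c : RT n) (f : PS n) (j : ℕ) :
    coeff (Finsupp.single j 1) (Omega c * f) =
      coeff (Finsupp.single j 1) f + c * constantCoeff f := by
  simp [coeff_mul, Finsupp.antidiagonal_single, Finset.Nat.antidiagonal_succ, coeff_Omega]

theorem constantCoeff_refl (i : ZMod n) (f : PS n) :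
    constantCoeff (refl n i f) = reflRT n i (constantCoeff f) := by
  rcases eq_or_ne i 0 with rfl | hi
  · simpa only [map_mul, constantCoeff_Omega, one_mul, constantCoeff_map] using
      congrArg constantCoeff (Omega_mul_refl_zero f)
  · rw [refl_of_ne_zero hi, constantCoeff_map]

theorem refl_eq_self_of_D_eq_self {i : ZMod n} {f : PS n} (h : D n i f = f) :
    refl n i f = f := by
  rw [← sub_eq_zero, ← T_spec, add_eq_right.1 h, mul_zero]

theorem coeff_D_eq_coeff_of_coeff_refl (hn : 2 ≤ n) {i : ZMod n} {f : PS n} {m : ℕ →₀ ℕ}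
    (h : coeff m (refl n i f) = coeff m f) : coeff m (D n i f) = coeff m f := by
  have : NeZero n := ⟨by lia⟩
  refine mul_left_cancel₀ (one_sub_ex_simpleRoot_ne_zero i hn) ?_
  rw [← coeff_C_mul, C_mul_D, map_sub, coeff_C_mul, h]
  ring

theorem constantCoeff_foldr_D (hn : 2 ≤ n) (w : List (ZMod n)) :
    constantCoeff (w.foldr (D n) 1) = 1 := by
  induction w with
  | nil => exact map_one _
  | cons i w ih =>
    rw [← coeff_zero_eq_constantCoeff_apply] at ih ⊢
    rw [List.foldr_cons, coeff_D_eq_coeff_of_coeff_refl hn, ih]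
    rw [coeff_zero_eq_constantCoeff_apply, constantCoeff_refl, ← coeff_zero_eq_constantCoeff_apply,
      ih, map_one]

theorem coeff_single_D_zero_one (hn : 2 ≤ n) (j : ℕ) :
    coeff (Finsupp.single j 1) (D n 0 1) = ex (-a n 0) := by
  have : NeZero n := ⟨by lia⟩
  have hone : coeff (Finsupp.single j 1) (1 : PS n) = 0 := by
    classical exact (coeff_one _).trans (if_neg (by simp))
  have hrefl : coeff (Finsupp.single j 1) (refl n 0 1) + b n 0 = b n 1 := by
    simpa only [coeff_single_Omega_mul, constantCoeff_refl, map_one, mul_one, hone, zero_add,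
      coeff_Omega, Finsupp.degree_single, pow_one] using
      congrArg (coeff (Finsupp.single j 1)) (Omega_mul_refl_zero (n := n) 1)
  have hex : ex (-a n 1) = ex (simpleRoot n 0) * ex (-a n 0) := by
    rw [← ex_add, simpleRoot, zero_add]
    congr 1
    abel
  refine mul_left_cancel₀ (one_sub_ex_simpleRoot_ne_zero 0 hn) ?_
  rw [← coeff_C_mul, C_mul_D, map_sub, coeff_C_mul, hone, eq_sub_of_add_eq hrefl, b, b, hex]
  ring

end LowDegree

section TwoOne

variable {lam mu : YoungDiagram}

theorem rowLen_colLen_of_rowLens_two (hmu : mu.rowLens = [2]) :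
    mu.rowLen 0 = 2 ∧ mu.colLen 0 = 1 := by
  have hc : mu.colLen 0 = 1 := by rw [← YoungDiagram.length_rowLens, hmu]; rfl
  simpa [YoungDiagram.rowLens, hc] using hmu

theorem rowLen_colLen_of_rowLens_two_one (hlam : lam.rowLens = [2, 1]) :
    lam.rowLen 0 = 2 ∧ lam.rowLen 1 = 1 ∧ lam.colLen 0 = 2 := by
  have hc : lam.colLen 0 = 2 := by rw [← YoungDiagram.length_rowLens, hlam]; rfl
  simpa [YoungDiagram.rowLens, hc, List.range_succ] using hlam

theorem redWord_of_rowLens_two (hmu : mu.rowLens = [2]) : redWord 3 mu = [1, 0] := by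
  obtain ⟨hr, hc⟩ := rowLen_colLen_of_rowLens_two hmu
  simp [redWord, hc, hr, List.range_succ, res]

theorem redWord_of_rowLens_two_one (hlam : lam.rowLens = [2, 1]) :
    redWord 3 lam = [2, 1, 0] := by
  obtain ⟨hr₀, hr₁, hc⟩ := rowLen_colLen_of_rowLens_two_one hlam
  simp [redWord, hc, hr₀, hr₁, List.range_succ, res, show (-1 : ZMod 3) = 2 from rfl]

theorem gTilde_of_rowLens_two (hmu : mu.rowLens = [2]) : gTilde 3 mu = D 3 1 (D 3 0 1) := by
  rw [gTilde, redWord_of_rowLens_two hmu]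
  rfl

theorem gTilde_of_rowLens_two_one (hlam : lam.rowLens = [2, 1]) (hmu : mu.rowLens = [2]) :
    gTilde 3 lam = D 3 2 (gTilde 3 mu) := by
  rw [gTilde, redWord_of_rowLens_two_one hlam, gTilde, redWord_of_rowLens_two hmu]
  rfl

theorem g_of_rowLens_two_one (hlam : lam.rowLens = [2, 1]) (hmu : mu.rowLens = [2]) :
    g 3 lam = T 3 2 (g 3 mu) := by
  rw [g, redWord_of_rowLens_two_one hlam, g, redWord_of_rowLens_two hmu]
  rfl

theorem wordWeight_one_zero : wordWeight 3 [1, 0] = simpleRoot 3 2 := by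
  simp only [wordWeight, List.map_cons, List.map_nil, List.sum_cons, List.sum_nil, simpleRoot,
    zero_add, show (1 + 1 : ZMod 3) = 2 from rfl, show (2 + 1 : ZMod 3) = 0 from rfl]
  abel

/-- The word stops being minuscule at the box of residue `2`: the weight reached there is `α_2`,
whose pairing with `α_2^∨` is `2`. -/
theorem isSigma_g_of_rowLens_two_one (hlam : lam.rowLens = [2, 1]) (hmu : mu.rowLens = [2]) :
    IsSigma (g 3 lam) (gTilde 3 mu + C (ex (a 3 3 - a 3 2)) * gTilde 3 lam) := by
  obtain ⟨hr, hc⟩ := rowLen_colLen_of_rowLens_two hmu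
  have hweight : wordWeight 3 (redWord 3 mu) = simpleRoot 3 2 := by
    rw [redWord_of_rowLens_two hmu, wordWeight_one_zero]
  have hpair : levelOnePairing 3 2 (wordWeight 3 (redWord 3 mu)) = (1 : ℕ) + 1 := by
    rw [levelOnePairing, if_neg (by decide), zero_add, hweight, coroot_simpleRoot 2 (by decide)]
    rfl
  have hroot : simpleRoot 3 2 - 2 • simpleRoot 3 2 = a 3 3 - a 3 2 := by
    rw [two_nsmul, sub_add_cancel_left, simpleRoot, neg_sub]
    rfl
  have hmin : IsMinusculeWord 3 (redWord 3 mu) := isMinusculeWord_redWord (by rw [hr, hc])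
  have h := (hmin.isSigma_foldr_T (by decide)).T_of_levelOnePairing_eq (by decide) hpair
  rw [hweight, one_add_one_eq_two, hroot, Finset.sum_range_one, zero_add, one_nsmul, sub_self,
    ex_zero, map_one, one_mul, add_comm] at h
  rwa [g_of_rowLens_two_one hlam hmu, gTilde_of_rowLens_two_one hlam hmu]

theorem gTilde_two_one_ne_gTilde_two (hlam : lam.rowLens = [2, 1]) (hmu : mu.rowLens = [2]) :
    gTilde 3 lam ≠ gTilde 3 mu := by
  intro h
  have hlin : coeff (Finsupp.single 0 1) (gTilde 3 mu) = ex (-a 3 0) := by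
    rw [gTilde_of_rowLens_two hmu, coeff_D_eq_coeff_of_coeff_refl (by decide),
      coeff_single_D_zero_one (by decide)]
    rw [refl_of_ne_zero (by decide), coeff_map, coeff_single_D_zero_one (by decide), reflRT_ex,
      map_neg, reflChar_a]
    rfl
  have hrefl : refl 3 2 (gTilde 3 mu) = gTilde 3 mu :=
    refl_eq_self_of_D_eq_self ((gTilde_of_rowLens_two_one hlam hmu).symm.trans h)
  have hcoeff := congrArg (coeff (Finsupp.single 0 1)) hrefl
  rw [refl_of_ne_zero (by decide), coeff_map, hlin, reflRT_ex, map_neg, reflChar_a] at hcoeff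
  have ha : a 3 2 = a 3 0 := neg_injective (ex_injective 3 hcoeff)
  have hcoroot := congrArg (coroot 3 0) ha
  rw [coroot_a, coroot_a] at hcoroot
  exact absurd hcoroot (by decide)

/-- Every `D`-word applied to `1` has constant coefficient `1`, which forces `c = 1 + e^{a_3 - a_2}`
and then `g̃_{(2,1)} = g̃_{(2)}`. -/
theorem not_isSigma_g_C_mul_of_rowLens_two_one (hlam : lam.rowLens = [2, 1])
    (hmu : mu.rowLens = [2]) (c : RT 3) : ¬ IsSigma (g 3 lam) (C c * gTilde 3 lam) := by
  intro h
  have heq := h.unique (isSigma_g_of_rowLens_two_one hlam hmu)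
  have hc : c = 1 + ex (a 3 3 - a 3 2) := by
    simpa only [map_add, map_mul, constantCoeff_C, gTilde, mul_one,
      constantCoeff_foldr_D (show 2 ≤ 3 by decide)] using congrArg constantCoeff heq
  rw [hc, map_add, map_one, add_mul, one_mul, add_left_inj] at heq
  exact gTilde_two_one_ne_gTilde_two hlam hmu heq

end TwoOne

end DoubleKSchur

theorem mainTheorem10 :
    (∀ n : ℕ, 2 ≤ n → ∀ lam : YoungDiagram, DoubleKSchur.IsKSmall n lam →
      ∀ F : DoubleKSchur.PS n,
        DoubleKSchur.IsSigma (DoubleKSchur.g n lam) F ↔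
          F = MvPowerSeries.C (DoubleKSchur.diagMonomial n lam) * DoubleKSchur.gTilde n lam) ∧
    (∀ lam mu : YoungDiagram, lam.rowLens = [2, 1] → mu.rowLens = [2] →
      (DoubleKSchur.IsKBounded 3 lam ∧ ¬ DoubleKSchur.IsKSmall 3 lam) ∧
      (∀ F : DoubleKSchur.PS 3,
        DoubleKSchur.IsSigma (DoubleKSchur.g 3 lam) F ↔
          F = DoubleKSchur.gTilde 3 mu +
            MvPowerSeries.C (DoubleKSchur.ex (DoubleKSchur.a 3 3 - DoubleKSchur.a 3 2)) *
              DoubleKSchur.gTilde 3 lam) ∧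
      (∀ c : DoubleKSchur.RT 3,
        ¬ DoubleKSchur.IsSigma (DoubleKSchur.g 3 lam)
          (MvPowerSeries.C c * DoubleKSchur.gTilde 3 lam))) := by
  refine ⟨fun n hn lam hlam F => ?_, fun lam mu hlam hmu => ⟨?_, fun F => ?_, ?_⟩⟩
  · have : NeZero n := ⟨by lia⟩
    exact (DoubleKSchur.isSigma_g_of_isKSmall hn hlam).iff_eq
  · obtain ⟨hr, -, hc⟩ := DoubleKSchur.rowLen_colLen_of_rowLens_two_one hlam
    rw [DoubleKSchur.IsKSmall, DoubleKSchur.IsKBounded, hr, hc]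
    decide
  · exact (DoubleKSchur.isSigma_g_of_rowLens_two_one hlam hmu).iff_eq
  · exact DoubleKSchur.not_isSigma_g_C_mul_of_rowLens_two_one hlam hmu
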